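/- Let $M$ be a compact topological space with a finite Radon measure $\mu$. Let $\mathcal E$ be a Dirichlet form on $L^2(M,\mu)$: a nonnegative, closed, symmetric bilinear form with dense domain $\mathcal D(\mathcal E)\subset L^2(M,\mu)$ such that, writing $\mathcal E(v)=\mathcal E(v,v)$, for every $v\in\mathcal D(\mathcal E)$ one has $|v|\in\mathcal D(\mathcal E)$ and $\mathcal E(|v|)\le\mathcal E(v)$, and, if $v\ge 0$, also $\min(v,1)\in\mathcal D(\mathcal E)$ and $\mathcal E(\min(v,1))\le\mathcal E(v)$. Assume that: (1) $\mathcal E$ is regular: $\mathcal D(\mathcal E)\cap C^0(M)$ is dense in $\mathcal D(\mathcal E)$ for the norm $(\mathcal E(v)+\|v\|_{L^2}^2)^{1/2}$ and in $C^0(M)$ for the uniform norm; (2) $\mathcal E$ is strongly local: $\mathcal E(u,v)=0$ whenever $u,v\in\mathcal D(\mathcal E)$ and $u$ is constant in a neighborhood of $\operatorname{supp} v$; (3) the Sobolev inequality holds: for some $\nu>2$ and $A,B>0$, $$\|v\|^2_{L^{2\nu/(\nu-2)}}\le A\,\mathcal E(v)+B\,\|v\|_{L^2}^2\qquad\text{for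 all } v\in\mathcal D(\mathcal E).$$ Let $W\in L^1(M,\mu)$ be real-valued with $W_+=\max(W,0)$ infinitesimally form bounded: for every $\varepsilon>0$ there is $c(\varepsilon)$ such that $\int_M W_+v^2\,d\mu\le\varepsilon\,\mathcal E(v)+c(\varepsilon)\int_M v^2\,d\mu$ for all $v\in\mathcal D(\mathcal E)$. Let $L$ be the generator of $\mathcal E$ and let $u\in\mathcal D(\mathcal E)$, $u\ge 0$, be a weak solution of $Lu=Wu$, i.e. for every bounded $\varphi\in\mathcal D(\mathcal E)$ (in particular, it suffices that this hold for all $\varphi\in\mathcal D(\mathcal E)$) the function $Wu\varphi$ is integrable and $$\mathcal E(u,\varphi)=\int_M W u\varphi\,d\mu .$$ Then $u\in L^q(M,\mu)$ for every real $q\ge 2$. -/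

import Mathlib

open MeasureTheory Filter Topology

/-- A Dirichlet form on `L²(M, μ)`, for a finite measure `μ`: a densely defined, nonnegative, closed
symmetric bilinear form that satisfies the two Beurling-Deny (Markov) conditions. -/
structure DirichletForm {M : Type*} [MeasurableSpace M] (μ : Measure M) [IsFiniteMeasure μ] where
  /-- the domain `𝒟(ℰ)` -/
  domain : Submodule ℝ (Lp ℝ 2 μ)
  /-- the bilinear form `ℰ(·, ·)` -/
  form : domain →ₗ[ℝ] domain →ₗ[ℝ] ℝ
  dense_domain : Dense (domain : Set (Lp ℝ 2 μ))
  symm : ∀ u v : domain, form u v = form v u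
  nonneg : ∀ v : domain, 0 ≤ form v v
  /-- `𝒟(ℰ)` is complete for the norm whose square is `ℰ₁(v) = ℰ(v, v) + ‖v‖²_{L²}` -/
  closed : ∀ v : ℕ → domain,
    Tendsto (fun p : ℕ × ℕ => form (v p.1 - v p.2) (v p.1 - v p.2) + ‖v p.1 - v p.2‖ ^ 2)
      atTop (𝓝 0) →
    ∃ w : domain, Tendsto (fun n => form (v n - w) (v n - w) + ‖v n - w‖ ^ 2) atTop (𝓝 0)
  abs_contraction : ∀ v : domain, ∃ h : |(v : Lp ℝ 2 μ)| ∈ domain,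
    form ⟨|(v : Lp ℝ 2 μ)|, h⟩ ⟨|(v : Lp ℝ 2 μ)|, h⟩ ≤ form v v
  inf_one_contraction : ∀ v : domain, 0 ≤ (v : Lp ℝ 2 μ) →
    ∃ h : (v : Lp ℝ 2 μ) ⊓ Lp.const 2 μ (1 : ℝ) ∈ domain,
      form ⟨(v : Lp ℝ 2 μ) ⊓ Lp.const 2 μ (1 : ℝ), h⟩
        ⟨(v : Lp ℝ 2 μ) ⊓ Lp.const 2 μ (1 : ℝ), h⟩ ≤ form v v

namespace DirichletForm

section Measure

variable {M : Type*} [MeasurableSpace M] {μ : Measure M} [IsFiniteMeasure μ]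

/-- The Sobolev inequality `‖v‖²_{L^{2ν/(ν-2)}} ≤ A ℰ(v) + B ‖v‖²_{L²}` for all `v ∈ 𝒟(ℰ)`. The
left-hand side is an extended real number, so the membership of `v` in `L^{2ν/(ν-2)}` is included. -/
def SobolevInequality (E : DirichletForm μ) (ν A B : ℝ) : Prop :=
  ∀ v : E.domain,
    eLpNorm ((v : Lp ℝ 2 μ) : M → ℝ) (ENNReal.ofReal (2 * ν / (ν - 2))) μ ^ 2
      ≤ ENNReal.ofReal (A * E.form v v + B * ‖v‖ ^ 2)

/-- A nonnegative function `W` is infinitesimally form bounded with respect to `ℰ`: for every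
`ε > 0` there is `c(ε)` such that `∫ W v² dμ ≤ ε ℰ(v) + c(ε) ∫ v² dμ` for all `v ∈ 𝒟(ℰ)`. -/
def InfinitesimallyFormBounded (E : DirichletForm μ) (W : M → ℝ) : Prop :=
  ∀ ε : ℝ, 0 < ε → ∃ c : ℝ, 0 ≤ c ∧ ∀ v : E.domain,
    ∫⁻ x, ENNReal.ofReal (W x * ((v : Lp ℝ 2 μ) x) ^ 2) ∂μ
      ≤ ENNReal.ofReal (ε * E.form v v + c * ‖v‖ ^ 2)

/-- `u ∈ 𝒟(ℰ)` is a (weak) solution of `L u = W u`, where `L` is the generator of `ℰ`: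
`ℰ(u, φ) = ∫ W u φ dμ`, the integral being absolutely convergent, for every (essentially) bounded
`φ ∈ 𝒟(ℰ)`. This is implied by the same identity for all `φ ∈ 𝒟(ℰ)`, in particular by the operator
identity `L u = W u` in `L²`. It is also implied by the identity for all `φ` in the form domain
`{φ ∈ 𝒟(ℰ) : ∫ |W| φ² dμ < ∞}` when `W` is integrable and `u` belongs to that form domain. -/
def IsSolution (E : DirichletForm μ) (W : M → ℝ) (u : E.domain) : Prop :=
  ∀ φ : E.domain, (∃ C : ℝ, ∀ᵐ x ∂μ, |(φ : Lp ℝ 2 μ) x| ≤ C) →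
    Integrable (fun x => W x * (u : Lp ℝ 2 μ) x * (φ : Lp ℝ 2 μ) x) μ ∧
    E.form u φ = ∫ x, W x * (u : Lp ℝ 2 μ) x * (φ : Lp ℝ 2 μ) x ∂μ

end Measure

section Topology

variable {M : Type*} [TopologicalSpace M] [MeasurableSpace M] {μ : Measure M} [IsFiniteMeasure μ]

/-- The support of (the class of) a function `v`: the complement of the union of all open sets on
which `v = 0` almost everywhere. -/
def essSupport (μ : Measure M) (v : M → ℝ) : Set M :=
  {x | ∀ U : Set M, IsOpen U → x ∈ U → ¬ ∀ᵐ y ∂μ, y ∈ U → v y = 0}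

/-- Strong locality: `ℰ(u, v) = 0` if `u` is constant in a neighborhood of the support of `v`. -/
def StronglyLocal (E : DirichletForm μ) : Prop :=
  ∀ u v : E.domain,
    (∃ (U : Set M) (c : ℝ), IsOpen U ∧ essSupport μ ((v : Lp ℝ 2 μ) : M → ℝ) ⊆ U ∧
      ∀ᵐ x ∂μ, x ∈ U → (u : Lp ℝ 2 μ) x = c) →
    E.form u v = 0

/-- Regularity: `𝒟(ℰ) ∩ C⁰(M)` is dense in `𝒟(ℰ)` for the norm `ℰ₁^{1/2}` and in `C⁰(M)` for the
uniform norm. -/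
def IsRegular [CompactSpace M] [BorelSpace M] (E : DirichletForm μ) : Prop :=
  (∀ v : E.domain, ∀ ε : ℝ, 0 < ε →
    ∃ (f : C(M, ℝ)) (hf : ContinuousMap.toLp 2 μ ℝ f ∈ E.domain),
      E.form (v - ⟨ContinuousMap.toLp 2 μ ℝ f, hf⟩) (v - ⟨ContinuousMap.toLp 2 μ ℝ f, hf⟩)
        + ‖v - ⟨ContinuousMap.toLp 2 μ ℝ f, hf⟩‖ ^ 2 < ε) ∧
  Dense {f : C(M, ℝ) | ContinuousMap.toLp 2 μ ℝ f ∈ E.domain}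

end Topology

end DirichletForm

/-! This is Moser iteration. If `u ∈ L^p`, test the equation with `F(u)` and apply Sobolev to
`G(u)`, where `F' = (G')²` and `G(t)` is comparable to `t^(p/2)`. This gives `u ∈ L^(pκ)` with `κ =
ν/(ν-2) > 1`, and iterating reaches every exponent.

In place of a chain rule, `G` is piecewise linear with slopes `β^i`, `β = 2^((p-2)/2)`, on dyadic
intervals, so `G(u)` is a combination of slices `s i` of `u`. A later slice lives only where an
earlier one is at full height, and the Markov property then forces `E(s i, s j) ≥ 0`
(`form_nonneg_of_saturated`). With `2 b_i b_j ≤ b_i² + b_j²` this yields `E(G(u)) ≤ E(u, F(u))`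
(`form_sum_le`).

Two cutoffs are needed: slopes are frozen at index `n`, and the functions are constant above `2^m`,
which makes `F(u)` a bounded test function. Where `u ≤ 2^m`, `u F(u) ≤ 4β G(u)²`, so form
boundedness absorbs the potential; where `u > 2^m`, a large `m = m(n)` makes the remainder at most
1. The bound on `E(G(u))` is uniform in `n`, and Fatou removes the cutoffs. -/

/-! ### Dyadic slices and piecewise linear functions -/

/-- The part of `a` between two consecutive dyadic levels: `min a 1` for `i = 0`, and
`min a 2 ^ i - min a 2 ^ (i - 1)` for `i > 0`. -/
noncomputable def dyadicSlice : ℕ → ℝ → ℝ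
  | 0, a => min a 1
  | i + 1, a => min a (2 ^ (i + 1)) - min a (2 ^ i)

theorem dyadicSlice_nonneg (i : ℕ) {a : ℝ} (ha : 0 ≤ a) : 0 ≤ dyadicSlice i a := by
  cases i with
  | zero => exact le_min ha zero_le_one
  | succ i =>
    have : (2 : ℝ) ^ i ≤ 2 ^ (i + 1) := pow_le_pow_right₀ one_le_two (Nat.le_succ i)
    exact sub_nonneg.2 (min_le_min_left a this)

theorem sum_dyadicSlice (m : ℕ) (a : ℝ) :
    ∑ i ∈ Finset.range (m + 1), dyadicSlice i a = min a (2 ^ m) := by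
  induction m with
  | zero => simp [dyadicSlice]
  | succ m ih => rw [Finset.sum_range_succ, ih]; simp [dyadicSlice]

theorem dyadicSlice_eq_zero {i k : ℕ} (hik : k < i) {a : ℝ} (ha : a ≤ 2 ^ k) :
    dyadicSlice i a = 0 := by
  cases i with
  | zero => omega
  | succ i =>
    have h1 : (2 : ℝ) ^ k ≤ 2 ^ i := pow_le_pow_right₀ one_le_two (by omega)
    have h2 : (2 : ℝ) ^ i ≤ 2 ^ (i + 1) := pow_le_pow_right₀ one_le_two (Nat.le_succ i)
    simp [dyadicSlice, min_eq_left (ha.trans h1), min_eq_left (ha.trans (h1.trans h2))]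

/-- The height of the `i`-th dyadic slice. -/
noncomputable def dyadicHeight (i : ℕ) : ℝ := dyadicSlice i (2 ^ i)

theorem dyadicSlice_eq_height {i : ℕ} {a : ℝ} (ha : 2 ^ i ≤ a) :
    dyadicSlice i a = dyadicHeight i := by
  cases i with
  | zero => simp at ha; simp [dyadicHeight, dyadicSlice, ha]
  | succ i =>
    have h2 : (2 : ℝ) ^ i ≤ 2 ^ (i + 1) := pow_le_pow_right₀ one_le_two (Nat.le_succ i)
    simp [dyadicHeight, dyadicSlice, min_eq_right ha, min_eq_right h2, min_eq_right (h2.trans ha)]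

theorem pow_le_two_mul_dyadicHeight (i : ℕ) : 2 ^ i ≤ 2 * dyadicHeight i := by
  cases i with
  | zero => simp [dyadicHeight, dyadicSlice]
  | succ i =>
    have h2 : (2 : ℝ) ^ i ≤ 2 ^ (i + 1) := pow_le_pow_right₀ one_le_two (Nat.le_succ i)
    simp only [dyadicHeight, dyadicSlice, min_self, min_eq_right h2]
    rw [pow_succ]; linarith

theorem dyadicHeight_pos (i : ℕ) : 0 < dyadicHeight i := by
  have := pow_le_two_mul_dyadicHeight i
  have h : (0 : ℝ) < 2 ^ i := by positivity
  linarith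

theorem dyadicSlice_le_height (i : ℕ) (a : ℝ) : dyadicSlice i a ≤ dyadicHeight i := by
  rcases le_total (2 ^ i) a with h | h
  · exact (dyadicSlice_eq_height h).le
  · cases i with
    | zero => simp [dyadicHeight, dyadicSlice]
    | succ i =>
      have h2 : (2 : ℝ) ^ i ≤ 2 ^ (i + 1) := pow_le_pow_right₀ one_le_two (Nat.le_succ i)
      simp only [dyadicHeight, dyadicSlice, min_self, min_eq_right h2, min_eq_left h]
      rcases le_total a (2 ^ i) with h' | h'
      · rw [min_eq_left h']; linarith
      · rw [min_eq_right h']; linarith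

/-- The piecewise linear function with slope `b i` on the `i`-th dyadic interval for `i ≤ m`, which
is constant above `2 ^ m`. -/
noncomputable def dyadicSum (b : ℕ → ℝ) (m : ℕ) (a : ℝ) : ℝ :=
  ∑ i ∈ Finset.range (m + 1), b i * dyadicSlice i a

section DyadicSum

variable {b : ℕ → ℝ} {m : ℕ} {a : ℝ}

theorem dyadicSum_nonneg (hb : ∀ i, 0 ≤ b i) (ha : 0 ≤ a) : 0 ≤ dyadicSum b m a :=
  Finset.sum_nonneg fun i _ => mul_nonneg (hb i) (dyadicSlice_nonneg i ha)

theorem mul_dyadicSlice_le_dyadicSum (hb : ∀ i, 0 ≤ b i) (ha : 0 ≤ a) {k : ℕ} (hk : k ≤ m) :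
    b k * dyadicSlice k a ≤ dyadicSum b m a :=
  Finset.single_le_sum (f := fun i => b i * dyadicSlice i a)
    (fun i _ => mul_nonneg (hb i) (dyadicSlice_nonneg i ha)) (Finset.mem_range.2 (by omega))

theorem mul_pow_le_dyadicSum (hb : ∀ i, 0 ≤ b i) {k : ℕ} (hk : k ≤ m) (ha : 2 ^ k ≤ a) :
    b k * 2 ^ k ≤ 2 * dyadicSum b m a := by
  have h0 : (0 : ℝ) ≤ a := le_trans (by positivity) ha
  have h1 := mul_dyadicSlice_le_dyadicSum hb h0 hk
  rw [dyadicSlice_eq_height ha] at h1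
  have h2 := mul_le_mul_of_nonneg_left (pow_le_two_mul_dyadicHeight k) (hb k)
  linarith

/-- Only slices with `i ≤ k` contribute when `a ≤ 2 ^ k`, and for these `b i ^ 2 ≤ b k * b i`. -/
theorem dyadicSum_sq_le (hb : ∀ i, 0 ≤ b i) (hmono : Monotone b) (ha : 0 ≤ a) {k : ℕ}
    (hk : a ≤ 2 ^ k) : dyadicSum (fun i => b i ^ 2) m a ≤ b k * dyadicSum b m a := by
  rw [dyadicSum, dyadicSum, Finset.mul_sum]
  refine Finset.sum_le_sum fun i _ => ?_
  rcases lt_or_ge k i with h | h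
  · simp [dyadicSlice_eq_zero h hk]
  · have h1 := mul_nonneg (hb i) (dyadicSlice_nonneg i ha)
    have := mul_le_mul_of_nonneg_right (hmono h) h1
    nlinarith

theorem dyadicSum_le_mul_of_le {C : ℝ} (hb : ∀ i, b i ≤ C) (ha : 0 ≤ a) :
    dyadicSum b m a ≤ C * min a (2 ^ m) := by
  rw [dyadicSum, ← sum_dyadicSlice, Finset.mul_sum]
  exact Finset.sum_le_sum fun i _ => mul_le_mul_of_nonneg_right (hb i) (dyadicSlice_nonneg i ha)

theorem dyadicSum_le (hb : ∀ i, 0 ≤ b i) (hmono : Monotone b) (ha : 0 ≤ a) {k : ℕ}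
    (hk : a ≤ 2 ^ k) : dyadicSum b m a ≤ b k * a := by
  have h : dyadicSum b m a ≤ b k * min a (2 ^ m) := by
    rw [dyadicSum, ← sum_dyadicSlice, Finset.mul_sum]
    refine Finset.sum_le_sum fun i _ => ?_
    rcases lt_or_ge k i with h | h
    · simp [dyadicSlice_eq_zero h hk]
    · exact mul_le_mul_of_nonneg_right (hmono h) (dyadicSlice_nonneg i ha)
  exact h.trans (mul_le_mul_of_nonneg_left (min_le_left _ _) (hb k))

end DyadicSum

/-! ### Geometric slopes: comparison with powers -/

/-- Slopes that grow geometrically with ratio `β` up to the index `n`, and are constant beyond. -/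
def truncPow (β : ℝ) (n i : ℕ) : ℝ := β ^ min i n

section TruncPow

variable {β : ℝ} {n m : ℕ} {a : ℝ}

theorem one_le_truncPow (hβ : 1 ≤ β) (i : ℕ) : 1 ≤ truncPow β n i := one_le_pow₀ hβ

theorem truncPow_nonneg (hβ : 1 ≤ β) (i : ℕ) : 0 ≤ truncPow β n i :=
  zero_le_one.trans (one_le_truncPow hβ i)

theorem truncPow_mono (hβ : 1 ≤ β) : Monotone (truncPow β n) := fun _ _ h =>
  pow_le_pow_right₀ hβ (min_le_min_right n h)

theorem truncPow_succ_le (hβ : 1 ≤ β) (k : ℕ) : truncPow β n (k + 1) ≤ β * truncPow β n k := by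
  rw [truncPow, truncPow, ← pow_succ']
  exact pow_le_pow_right₀ hβ (by omega)

theorem truncPow_le_pow (hβ : 1 ≤ β) (k : ℕ) : truncPow β n k ≤ β ^ k :=
  pow_le_pow_right₀ hβ (min_le_left _ _)

theorem truncPow_le_top (hβ : 1 ≤ β) (k : ℕ) : truncPow β n k ≤ β ^ n :=
  pow_le_pow_right₀ hβ (min_le_right _ _)

theorem min_one_le_dyadicSum (hβ : 1 ≤ β) (ha : 0 ≤ a) :
    min a 1 ≤ dyadicSum (truncPow β n) m a := by
  have := mul_dyadicSlice_le_dyadicSum (m := m) (truncPow_nonneg (n := n) hβ) ha (Nat.zero_le m)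
  simpa [truncPow, dyadicSlice] using this

/-- Neighbouring slopes differ by a factor of at most `β`, so slope times `a` is controlled by the
value of `G`. The constant depends on neither `n` nor `m`; `a ≤ 2 ^ m` matters because `G` stops
growing there. -/
theorem mul_dyadicSum_sq_le (hβ : 1 ≤ β) (ha : 0 ≤ a) (ham : a ≤ 2 ^ m) :
    a * dyadicSum (fun i => truncPow β n i ^ 2) m a
      ≤ 4 * β * dyadicSum (truncPow β n) m a ^ 2 := by
  have hb := truncPow_nonneg (n := n) hβ
  set G := dyadicSum (truncPow β n) m a with hG
  have hG0 : 0 ≤ G := dyadicSum_nonneg hb ha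
  rcases le_or_gt a 1 with h1 | h1
  · have h2 := dyadicSum_sq_le (m := m) hb (truncPow_mono hβ) ha (k := 0) (by simpa using h1)
    have h3 := min_one_le_dyadicSum (n := n) (m := m) hβ ha
    rw [min_eq_left h1] at h3
    have h4 : truncPow β n 0 = 1 := by simp [truncPow]
    rw [h4, one_mul] at h2
    calc _ ≤ G * G := mul_le_mul h3 h2 (dyadicSum_nonneg (fun i => sq_nonneg _) ha) hG0
      _ ≤ 4 * β * G ^ 2 := by nlinarith [sq_nonneg G]
  · obtain ⟨k, hk1, hk2⟩ := exists_nat_pow_near h1.le one_lt_two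
    have hkm : k ≤ m := (pow_le_pow_iff_right₀ (one_lt_two : (1 : ℝ) < 2)).1 (hk1.trans ham)
    have h2 := dyadicSum_sq_le (m := m) hb (truncPow_mono hβ) ha hk2.le
    have h3 := mul_pow_le_dyadicSum hb hkm hk1
    have h4 : truncPow β n (k + 1) * a ≤ 4 * β * G := by
      calc truncPow β n (k + 1) * a ≤ (β * truncPow β n k) * (2 ^ (k + 1)) :=
            mul_le_mul (truncPow_succ_le hβ k) hk2.le ha (mul_nonneg (by linarith) (hb k))
        _ = 2 * β * (truncPow β n k * 2 ^ k) := by ring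
        _ ≤ 2 * β * (2 * G) := mul_le_mul_of_nonneg_left h3 (by linarith)
        _ = _ := by ring
    calc _ ≤ a * (truncPow β n (k + 1) * G) := mul_le_mul_of_nonneg_left h2 ha
      _ = (truncPow β n (k + 1) * a) * G := by ring
      _ ≤ (4 * β * G) * G := mul_le_mul_of_nonneg_right h4 hG0
      _ = _ := by ring

theorem pow_rpow_two_half (p : ℝ) (k : ℕ) :
    ((2 : ℝ) ^ k) ^ ((p - 2) / 2) = ((2 : ℝ) ^ ((p - 2) / 2)) ^ k := by
  rw [← Real.rpow_natCast, ← Real.rpow_natCast, ← Real.rpow_mul zero_le_two,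
    ← Real.rpow_mul zero_le_two, mul_comm]

theorem one_le_two_rpow_half {p : ℝ} (hp : 2 ≤ p) : 1 ≤ (2 : ℝ) ^ ((p - 2) / 2) :=
  Real.one_le_rpow one_le_two (by linarith)

theorem rpow_half_eq_mul (p : ℝ) (ha : 0 < a) : a ^ (p / 2) = a * a ^ ((p - 2) / 2) := by
  rw [mul_comm, ← Real.rpow_add_one ha.ne']; congr 1; ring

/-- For `2 ^ k ≤ a < 2 ^ (k + 1)` the slopes met are at most `β ^ (k + 1) ≤ β * a ^ ((p - 2) / 2)`.
The term `a ^ 2` covers `a ≤ 1`, where the slope is 1. -/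
theorem dyadicSum_sq_le_rpow {p : ℝ} (hp : 2 ≤ p) (ha : 0 ≤ a) :
    dyadicSum (truncPow (2 ^ ((p - 2) / 2)) n) m a ^ 2
      ≤ a ^ 2 + (2 ^ ((p - 2) / 2)) ^ 2 * a ^ p := by
  have hβ := one_le_two_rpow_half hp
  set β : ℝ := 2 ^ ((p - 2) / 2) with hβdef
  have hb := truncPow_nonneg (n := n) hβ
  have hG0 : 0 ≤ dyadicSum (truncPow β n) m a := dyadicSum_nonneg hb ha
  have hap : 0 ≤ a ^ p := Real.rpow_nonneg ha p
  rcases le_or_gt a 1 with h1 | h1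
  · have h2 := dyadicSum_le (m := m) hb (truncPow_mono hβ) ha (k := 0) (by simpa using h1)
    have h4 : truncPow β n 0 = 1 := by simp [truncPow]
    rw [h4, one_mul] at h2
    have := pow_le_pow_left₀ hG0 h2 2
    have h5 : 0 ≤ β ^ 2 * a ^ p := by positivity
    linarith
  · obtain ⟨k, hk1, hk2⟩ := exists_nat_pow_near h1.le one_lt_two
    have ha0 : 0 < a := by linarith
    have h2 := dyadicSum_le (m := m) hb (truncPow_mono hβ) ha hk2.le
    have h3 : dyadicSum (truncPow β n) m a ≤ β * a ^ (p / 2) := by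
      calc _ ≤ truncPow β n (k + 1) * a := h2
        _ ≤ β ^ (k + 1) * a := mul_le_mul_of_nonneg_right (truncPow_le_pow hβ _) ha
        _ = β * (a * (2 ^ k) ^ ((p - 2) / 2)) := by rw [pow_rpow_two_half, ← hβdef]; ring
        _ ≤ β * (a * a ^ ((p - 2) / 2)) := by
            have := Real.rpow_le_rpow (by positivity) hk1 (by linarith : 0 ≤ (p - 2) / 2)
            gcongr
        _ = β * a ^ (p / 2) := by rw [rpow_half_eq_mul p ha0]
    have h4 := pow_le_pow_left₀ hG0 h3 2
    have h5 : (a ^ (p / 2)) ^ 2 = a ^ p := by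
      rw [← Real.rpow_natCast, ← Real.rpow_mul ha]; congr 1; push_cast; ring
    rw [mul_pow, h5] at h4
    nlinarith [sq_nonneg a]

theorem min_rpow_le_dyadicSum {p : ℝ} (hp : 2 ≤ p) (ha : 0 ≤ a) (hnm : n ≤ m) :
    min a (2 ^ n) ^ (p / 2)
      ≤ 4 * 2 ^ ((p - 2) / 2) * dyadicSum (truncPow (2 ^ ((p - 2) / 2)) n) m a := by
  have hβ := one_le_two_rpow_half hp
  set β : ℝ := 2 ^ ((p - 2) / 2) with hβdef
  have hb := truncPow_nonneg (n := n) hβ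
  set G := dyadicSum (truncPow β n) m a with hG
  have hG0 : 0 ≤ G := dyadicSum_nonneg hb ha
  set c := min a (2 ^ n) with hc
  have hc0 : 0 ≤ c := le_min ha (by positivity)
  rcases le_or_gt c 1 with h1 | h1
  · have h2 : c ^ (p / 2) ≤ c := by
      have := Real.rpow_le_rpow_of_exponent_ge' hc0 h1 zero_le_one (by linarith : 1 ≤ p / 2)
      simpa using this
    have h3 := min_one_le_dyadicSum (n := n) (m := m) hβ ha
    have h4 : c ≤ min a 1 := le_min (min_le_left _ _) h1
    nlinarith
  · obtain ⟨k, hk1, hk2⟩ := exists_nat_pow_near h1.le one_lt_two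
    have hkn : k ≤ n :=
      (pow_le_pow_iff_right₀ (one_lt_two : (1 : ℝ) < 2)).1 (hk1.trans (min_le_right _ _))
    have h3 := mul_pow_le_dyadicSum hb (hkn.trans hnm) (hk1.trans (min_le_left _ _))
    have h4 : truncPow β n k = β ^ k := by rw [truncPow, min_eq_left hkn]
    rw [h4] at h3
    calc c ^ (p / 2) = c * c ^ ((p - 2) / 2) := rpow_half_eq_mul p (by linarith)
      _ ≤ 2 ^ (k + 1) * (2 ^ (k + 1)) ^ ((p - 2) / 2) := by
          have := Real.rpow_le_rpow hc0 hk2.le (by linarith : 0 ≤ (p - 2) / 2)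
          have h0 : 0 ≤ c ^ ((p - 2) / 2) := Real.rpow_nonneg hc0 _
          gcongr
      _ = 2 * β * (β ^ k * 2 ^ k) := by rw [pow_rpow_two_half, ← hβdef]; ring
      _ ≤ 2 * β * (2 * G) := mul_le_mul_of_nonneg_left h3 (by linarith)
      _ = 4 * β * G := by ring

end TruncPow

/-! ### Consequences of the Markov property -/

namespace DirichletForm

section

variable {M : Type*} [MeasurableSpace M] {μ : Measure M} [IsFiniteMeasure μ]

theorem coeFn_add (E : DirichletForm μ) (v w : E.domain) :
    ((v + w : E.domain) : Lp ℝ 2 μ) =ᵐ[μ] fun x => (v : Lp ℝ 2 μ) x + (w : Lp ℝ 2 μ) x := by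
  rw [Submodule.coe_add]; exact Lp.coeFn_add _ _

theorem coeFn_sub (E : DirichletForm μ) (v w : E.domain) :
    ((v - w : E.domain) : Lp ℝ 2 μ) =ᵐ[μ] fun x => (v : Lp ℝ 2 μ) x - (w : Lp ℝ 2 μ) x := by
  rw [Submodule.coe_sub]; exact Lp.coeFn_sub _ _

theorem coeFn_smul (E : DirichletForm μ) (c : ℝ) (v : E.domain) :
    ((c • v : E.domain) : Lp ℝ 2 μ) =ᵐ[μ] fun x => c * (v : Lp ℝ 2 μ) x := by
  rw [Submodule.coe_smul]; exact Lp.coeFn_smul _ _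

theorem coeFn_sum_smul (E : DirichletForm μ) (b : ℕ → ℝ) (s : ℕ → E.domain) (n : ℕ) :
    ((∑ i ∈ Finset.range n, b i • s i : E.domain) : Lp ℝ 2 μ)
      =ᵐ[μ] fun x => ∑ i ∈ Finset.range n, b i * (s i : Lp ℝ 2 μ) x := by
  induction n with
  | zero =>
    simp only [Finset.range_zero, Finset.sum_empty, Submodule.coe_zero]
    exact Lp.coeFn_zero _ _ _
  | succ n ih =>
    rw [Finset.sum_range_succ]
    filter_upwards [coeFn_add E (∑ i ∈ Finset.range n, b i • s i) (b n • s n), ih,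
      coeFn_smul E (b n) (s n)] with x h1 h2 h3
    rw [h1, h2, h3, Finset.sum_range_succ]

theorem ext_ae (E : DirichletForm μ) {v w : E.domain}
    (h : (v : Lp ℝ 2 μ) =ᵐ[μ] (w : Lp ℝ 2 μ)) : v = w :=
  Subtype.ext (Lp.ext h)

theorem exists_min_const (E : DirichletForm μ) (v : E.domain)
    (hv : ∀ᵐ x ∂μ, 0 ≤ (v : Lp ℝ 2 μ) x) {h : ℝ} (hh : 0 < h) :
    ∃ w : E.domain, (∀ᵐ x ∂μ, (w : Lp ℝ 2 μ) x = min ((v : Lp ℝ 2 μ) x) h) ∧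
      E.form w w ≤ E.form v v := by
  set v' : E.domain := h⁻¹ • v with hv'
  have h0 : 0 ≤ (v' : Lp ℝ 2 μ) := by
    rw [← Lp.coeFn_nonneg]
    filter_upwards [coeFn_smul E h⁻¹ v, hv] with x hx h0
    rw [hx]; exact mul_nonneg (inv_nonneg.2 hh.le) h0
  obtain ⟨hmem, hle⟩ := E.inf_one_contraction v' h0
  refine ⟨h • ⟨_, hmem⟩, ?_, ?_⟩
  · filter_upwards [coeFn_smul E h ⟨_, hmem⟩, coeFn_smul E h⁻¹ v,
      Lp.coeFn_inf (v' : Lp ℝ 2 μ) (Lp.const 2 μ (1 : ℝ)), Lp.coeFn_const 2 μ (1 : ℝ)]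
      with x h1 h2 h3 h4
    rw [h1]
    simp only [h3, Pi.inf_apply, h4, Function.const]
    rw [hv', h2, mul_min_of_nonneg _ _ hh.le, mul_inv_cancel_left₀ hh.ne', mul_one]
  · have h2 : E.form v v = h * (h * E.form v' v') := by
      simp only [hv', map_smul, LinearMap.smul_apply, smul_eq_mul]; field_simp
    rw [h2]
    simp only [map_smul, LinearMap.smul_apply, smul_eq_mul]
    gcongr

theorem form_add_smul (E : DirichletForm μ) (v w : E.domain) (t : ℝ) :
    E.form (v + t • w) (v + t • w)
      = E.form v v + 2 * t * E.form v w + t ^ 2 * E.form w w := by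
  simp only [map_add, map_smul, LinearMap.add_apply, LinearMap.smul_apply, smul_eq_mul,
    E.symm w v]
  ring

/-- Since `w` lives where `v` has reached `h`, truncating `v + t • w` at `h` gives back `v`. Hence
`E(v) ≤ E(v + t w)` for all `t > 0`, and the first-order term in `t` must be nonnegative. -/
theorem form_nonneg_of_saturated (E : DirichletForm μ) (v w : E.domain) {h : ℝ} (hh : 0 < h)
    (hvw : ∀ᵐ x ∂μ, 0 ≤ (v : Lp ℝ 2 μ) x ∧ (v : Lp ℝ 2 μ) x ≤ h ∧ 0 ≤ (w : Lp ℝ 2 μ) x ∧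
      ((w : Lp ℝ 2 μ) x = 0 ∨ (v : Lp ℝ 2 μ) x = h)) :
    0 ≤ E.form v w := by
  have key : ∀ t : ℝ, 0 < t → 0 ≤ 2 * E.form v w + t * E.form w w := by
    intro t ht
    have hadd : ∀ᵐ x ∂μ, ((v + t • w : E.domain) : Lp ℝ 2 μ) x
        = (v : Lp ℝ 2 μ) x + t * (w : Lp ℝ 2 μ) x := by
      filter_upwards [coeFn_add E v (t • w), coeFn_smul E t w] with x h1 h2
      rw [h1, h2]
    obtain ⟨z, hz, hle⟩ := E.exists_min_const (v + t • w) (by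
      filter_upwards [hadd, hvw] with x h1 h2
      rw [h1]; exact add_nonneg h2.1 (mul_nonneg ht.le h2.2.2.1)) hh
    have hzv : z = v := by
      refine E.ext_ae ?_
      filter_upwards [hz, hadd, hvw] with x h1 h2 h3
      obtain ⟨-, h4, h5, h6⟩ := h3
      rw [h1, h2]
      rcases h6 with h6 | h6
      · rw [h6, mul_zero, add_zero, min_eq_left h4]
      · rw [h6]; exact min_eq_right (le_add_of_nonneg_right (mul_nonneg ht.le h5))
    rw [hzv, form_add_smul] at hle
    have : 0 ≤ t * (2 * E.form v w + t * E.form w w) := by linarith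
    exact nonneg_of_mul_nonneg_right this ht
  by_contra! hneg
  have hw := E.nonneg w
  have h1 : 0 < E.form w w + 1 := by linarith
  -- This `t` is so small that `t * E(w, w) ≤ -E(v, w)`; the `+ 1` avoids division by zero.
  have := key (-E.form v w / (E.form w w + 1)) (div_pos (by linarith) h1)
  have h2 : -E.form v w / (E.form w w + 1) * E.form w w ≤ -E.form v w := by
    rw [div_mul_eq_mul_div, div_le_iff₀ h1]; nlinarith
  linarith

/-- A discrete Stroock-Varopoulos inequality. -/
theorem form_sum_le (E : DirichletForm μ) (s : ℕ → E.domain) (r : E.domain) (b : ℕ → ℝ) (n : ℕ)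
    (hs : ∀ i j, i < j → 0 ≤ E.form (s i) (s j)) (hr : ∀ i < n, 0 ≤ E.form (s i) r) :
    E.form (∑ i ∈ Finset.range n, b i • s i) (∑ i ∈ Finset.range n, b i • s i)
      ≤ E.form (∑ i ∈ Finset.range n, s i + r) (∑ i ∈ Finset.range n, b i ^ 2 • s i) := by
  have hs' : ∀ i j, i ≠ j → 0 ≤ E.form (s i) (s j) := fun i j hij => by
    rcases lt_or_gt_of_ne hij with h | h
    · exact hs i j h
    · rw [E.symm]; exact hs j i h
  have hr' : 0 ≤ E.form r (∑ i ∈ Finset.range n, b i ^ 2 • s i) := by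
    rw [map_sum]
    refine Finset.sum_nonneg fun i hi => ?_
    rw [map_smul, smul_eq_mul, E.symm]
    exact mul_nonneg (sq_nonneg _) (hr i (Finset.mem_range.1 hi))
  have h1 : E.form (∑ i ∈ Finset.range n, b i • s i) (∑ i ∈ Finset.range n, b i • s i)
      = ∑ i ∈ Finset.range n, ∑ j ∈ Finset.range n, b i * b j * E.form (s i) (s j) := by
    simp only [map_sum, LinearMap.sum_apply, map_smul, LinearMap.smul_apply, smul_eq_mul,
      Finset.mul_sum]
    exact Finset.sum_congr rfl fun i _ => Finset.sum_congr rfl fun j _ => by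
      rw [E.symm (s j) (s i)]; ring
  have h2 : E.form (∑ i ∈ Finset.range n, s i) (∑ i ∈ Finset.range n, b i ^ 2 • s i)
      = ∑ i ∈ Finset.range n, ∑ j ∈ Finset.range n, b j ^ 2 * E.form (s i) (s j) := by
    simp only [map_sum, LinearMap.sum_apply, map_smul, smul_eq_mul, Finset.mul_sum]
    rw [Finset.sum_comm]
  have h3 : E.form (∑ i ∈ Finset.range n, s i) (∑ i ∈ Finset.range n, b i ^ 2 • s i)
      = ∑ i ∈ Finset.range n, ∑ j ∈ Finset.range n, b i ^ 2 * E.form (s i) (s j) := by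
    rw [h2, Finset.sum_comm]
    exact Finset.sum_congr rfl fun i _ => Finset.sum_congr rfl fun j _ => by rw [E.symm]
  -- Symmetrizing the double sum gives coefficients `b i ^ 2 + b j ^ 2` against `2 * b i * b j`.
  -- Diagonal terms cancel, and off-diagonal ones leave `(b i - b j) ^ 2 * E(s i, s j) ≥ 0`.
  have h4 : 2 * E.form (∑ i ∈ Finset.range n, b i • s i) (∑ i ∈ Finset.range n, b i • s i)
      ≤ E.form (∑ i ∈ Finset.range n, s i) (∑ i ∈ Finset.range n, b i ^ 2 • s i)
        + E.form (∑ i ∈ Finset.range n, s i) (∑ i ∈ Finset.range n, b i ^ 2 • s i) := by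
    nth_rw 1 [h2]
    rw [h3, h1, ← Finset.sum_add_distrib, Finset.mul_sum]
    refine Finset.sum_le_sum fun i _ => ?_
    rw [← Finset.sum_add_distrib, Finset.mul_sum]
    refine Finset.sum_le_sum fun j _ => ?_
    rcases eq_or_ne i j with rfl | hij
    · exact le_of_eq (by ring)
    · nlinarith [mul_nonneg (sq_nonneg (b i - b j)) (hs' i j hij)]
  rw [map_add, LinearMap.add_apply]
  linarith

theorem exists_dyadicSlice (E : DirichletForm μ) (u : E.domain)
    (hu : ∀ᵐ x ∂μ, 0 ≤ (u : Lp ℝ 2 μ) x) :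
    ∃ s : ℕ → E.domain, ∀ i, ∀ᵐ x ∂μ, (s i : Lp ℝ 2 μ) x = dyadicSlice i ((u : Lp ℝ 2 μ) x) := by
  choose T hT _ using fun i : ℕ => E.exists_min_const u hu (h := 2 ^ i) (by positivity)
  refine ⟨fun i => Nat.casesOn i (T 0) fun i => T (i + 1) - T i, fun i => ?_⟩
  cases i with
  | zero => simpa [dyadicSlice] using hT 0
  | succ i =>
    filter_upwards [coeFn_sub E (T (i + 1)) (T i), hT i, hT (i + 1)] with x h1 h2 h3
    simp only [dyadicSlice]
    rw [h1, h2, h3]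

theorem exists_dyadicSum (E : DirichletForm μ) (u : E.domain)
    (hu : ∀ᵐ x ∂μ, 0 ≤ (u : Lp ℝ 2 μ) x) (b : ℕ → ℝ) (m : ℕ) :
    ∃ g f : E.domain,
      (∀ᵐ x ∂μ, (g : Lp ℝ 2 μ) x = dyadicSum b m ((u : Lp ℝ 2 μ) x)) ∧
      (∀ᵐ x ∂μ, (f : Lp ℝ 2 μ) x = dyadicSum (fun i => b i ^ 2) m ((u : Lp ℝ 2 μ) x)) ∧
      E.form g g ≤ E.form u f := by
  obtain ⟨s, hs⟩ := E.exists_dyadicSlice u hu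
  have hsum : ∀ b : ℕ → ℝ, ∀ᵐ x ∂μ,
      ((∑ i ∈ Finset.range (m + 1), b i • s i : E.domain) : Lp ℝ 2 μ) x
        = dyadicSum b m ((u : Lp ℝ 2 μ) x) := fun b => by
    filter_upwards [coeFn_sum_smul E b s (m + 1), ae_all_iff.2 hs] with x h1 h2
    rw [h1]; simp only [h2, dyadicSum]
  refine ⟨∑ i ∈ Finset.range (m + 1), b i • s i, ∑ i ∈ Finset.range (m + 1), b i ^ 2 • s i,
    hsum b, hsum _, ?_⟩
  -- The remainder `(u - 2 ^ m)₊` lives where every slice up to `m` is saturated.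
  have hr : ∀ᵐ x ∂μ, ((u - ∑ i ∈ Finset.range (m + 1), s i : E.domain) : Lp ℝ 2 μ) x
      = (u : Lp ℝ 2 μ) x - min ((u : Lp ℝ 2 μ) x) (2 ^ m) := by
    have := hsum fun _ => 1
    simp only [one_smul] at this
    filter_upwards [coeFn_sub E u (∑ i ∈ Finset.range (m + 1), s i), this] with x h1 h2
    rw [h1, h2, ← sum_dyadicSlice]; simp [dyadicSum]
  have := E.form_sum_le s (u - ∑ i ∈ Finset.range (m + 1), s i) b (m + 1) ?_ ?_
  · rwa [add_sub_cancel] at this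
  · intro i j hij
    refine E.form_nonneg_of_saturated (s i) (s j) (dyadicHeight_pos i) ?_
    filter_upwards [hs i, hs j, hu] with x h1 h2 h3
    rw [h1, h2]
    refine ⟨dyadicSlice_nonneg i h3, dyadicSlice_le_height i _, dyadicSlice_nonneg j h3, ?_⟩
    rcases le_total ((u : Lp ℝ 2 μ) x) (2 ^ i) with h | h
    · exact Or.inl (dyadicSlice_eq_zero hij h)
    · exact Or.inr (dyadicSlice_eq_height h)
  · intro i hi
    refine E.form_nonneg_of_saturated (s i) _ (dyadicHeight_pos i) ?_
    filter_upwards [hs i, hr, hu] with x h1 h2 h3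
    rw [h1, h2]
    refine ⟨dyadicSlice_nonneg i h3, dyadicSlice_le_height i _,
      sub_nonneg.2 (min_le_left _ _), ?_⟩
    rcases le_total ((u : Lp ℝ 2 μ) x) (2 ^ i) with h | h
    · have h4 : (2 : ℝ) ^ i ≤ 2 ^ m := pow_le_pow_right₀ one_le_two (by omega)
      exact Or.inl (by rw [min_eq_left (h.trans h4), sub_self])
    · exact Or.inr (dyadicSlice_eq_height h)

end

end DirichletForm

/-! ### Integration lemmas -/

theorem ofReal_integral_le_lintegral {α : Type*} [MeasurableSpace α] {μ : Measure α} {f : α → ℝ}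
    (hf : Integrable f μ) : ENNReal.ofReal (∫ x, f x ∂μ) ≤ ∫⁻ x, ENNReal.ofReal (f x) ∂μ := by
  rw [integral_eq_lintegral_pos_part_sub_lintegral_neg_part hf]
  exact (ENNReal.ofReal_le_ofReal (sub_le_self _ ENNReal.toReal_nonneg)).trans
    ENNReal.ofReal_toReal_le

theorem exists_setLIntegral_two_pow_lt_le_one {α : Type*} [MeasurableSpace α] {μ : Measure α}
    [IsFiniteMeasure μ] {h : α → ENNReal} (hh : ∫⁻ x, h x ∂μ ≠ ⊤) {v : α → ℝ}
    (hv : Measurable v) (n : ℕ) :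
    ∃ m ≥ n, ∫⁻ x in {x | (2 : ℝ) ^ m < v x}, h x ∂μ ≤ 1 := by
  have h1 : Tendsto (μ ∘ fun m : ℕ => {x | (2 : ℝ) ^ m < v x}) atTop (𝓝 0) := by
    have h2 : ⋂ m : ℕ, {x | (2 : ℝ) ^ m < v x} = ∅ := by
      rw [Set.eq_empty_iff_forall_notMem]
      intro x hx
      obtain ⟨m, hm⟩ := pow_unbounded_of_one_lt (v x) one_lt_two
      exact absurd (Set.mem_iInter.1 hx m) (not_lt.2 hm.le)
    have h3 := tendsto_measure_iInter_atTop (μ := μ) (s := fun m : ℕ => {x | (2 : ℝ) ^ m < v x})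
      (fun m => (measurableSet_lt measurable_const hv).nullMeasurableSet)
      (fun i j hij x (hx : (2 : ℝ) ^ j < v x) =>
        show (2 : ℝ) ^ i < v x from (pow_le_pow_right₀ one_le_two hij).trans_lt hx)
      ⟨0, measure_ne_top _ _⟩
    rwa [h2, measure_empty] at h3
  have h4 := tendsto_setLIntegral_zero hh h1
  obtain ⟨m, hm, hmn⟩ :=
    ((h4.eventually (ge_mem_nhds (zero_lt_one' ENNReal))).and (eventually_ge_atTop n)).exists
  exact ⟨m, hmn, hm⟩

theorem L2_norm_sq_eq_integral {α : Type*} [MeasurableSpace α] {μ : Measure α} (v : Lp ℝ 2 μ) :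
    ‖v‖ ^ 2 = ∫ x, v x ^ 2 ∂μ := by
  rw [← real_inner_self_eq_norm_sq, L2.inner_def]
  simp [sq]

/-! ### Energy estimate and gain of integrability -/

namespace DirichletForm

section

variable {M : Type*} [MeasurableSpace M] {μ : Measure M} [IsFiniteMeasure μ]

/-- The point is that `C` does not depend on `n`: the slope cap `β ^ n` enters only the tail, which
the choice of `m` makes at most 1. -/
theorem exists_dyadicSum_form_le (E : DirichletForm μ) {W : M → ℝ}
    (hW : AEMeasurable W μ) (hWpos : E.InfinitesimallyFormBounded (fun x => max (W x) 0))
    {u : E.domain} (hu : ∀ᵐ x ∂μ, 0 ≤ (u : Lp ℝ 2 μ) x) (hsol : E.IsSolution W u)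
    {β : ℝ} (hβ : 1 ≤ β) :
    ∃ C : ℝ, 0 ≤ C ∧ ∀ n : ℕ, ∃ m ≥ n, ∃ g : E.domain,
      (∀ᵐ x ∂μ, (g : Lp ℝ 2 μ) x = dyadicSum (truncPow β n) m ((u : Lp ℝ 2 μ) x)) ∧
      E.form g g ≤ C * ‖g‖ ^ 2 + 2 := by
  have hβ0 : 0 < β := by linarith
  -- After multiplication by the `4 * β` of `mul_dyadicSum_sq_le`, exactly half of `E(g, g)` remains
  -- to be absorbed.
  obtain ⟨c, hc0, hc⟩ := hWpos (1 / (8 * β)) (by positivity)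
  refine ⟨8 * β * c, by positivity, fun n => ?_⟩
  set U : M → ℝ := fun x => (u : Lp ℝ 2 μ) x with hU
  have hUm : Measurable U := (Lp.stronglyMeasurable (u : Lp ℝ 2 μ)).measurable
  -- Form boundedness applied to `u` itself makes `W₊ u²` integrable; on the tail `F(u) ≤ β ^ (2n) *
  -- u`.
  have hfin : ∫⁻ x, ENNReal.ofReal (β ^ n) ^ 2 * ENNReal.ofReal (max (W x) 0 * U x ^ 2) ∂μ ≠ ⊤ := by
    rw [lintegral_const_mul' _ _ (by simp)]
    exact ENNReal.mul_ne_top (by simp) (ne_top_of_le_ne_top ENNReal.ofReal_ne_top (hc u))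
  obtain ⟨m, hmn, hm⟩ := exists_setLIntegral_two_pow_lt_le_one hfin hUm n
  obtain ⟨g, f, hg, hf, hgf⟩ := E.exists_dyadicSum u hu (truncPow β n) m
  refine ⟨m, hmn, g, hg, ?_⟩
  have hb := truncPow_nonneg (n := n) hβ
  have hb2 : ∀ i, truncPow β n i ^ 2 ≤ (β ^ n) ^ 2 := fun i =>
    pow_le_pow_left₀ (hb i) (truncPow_le_top hβ i) 2
  obtain ⟨hint, heq⟩ := hsol f ⟨(β ^ n) ^ 2 * 2 ^ m, by
    filter_upwards [hf, hu] with x h1 h2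
    rw [h1, abs_of_nonneg (dyadicSum_nonneg (fun i => sq_nonneg _) h2)]
    exact (dyadicSum_le_mul_of_le hb2 h2).trans
      (mul_le_mul_of_nonneg_left (min_le_right _ _) (sq_nonneg _))⟩
  have hpt : ∀ᵐ x ∂μ, ENNReal.ofReal (W x * U x * (f : Lp ℝ 2 μ) x)
      ≤ ENNReal.ofReal (4 * β) * ENNReal.ofReal (max (W x) 0 * (g : Lp ℝ 2 μ) x ^ 2)
        + Set.indicator {x | (2 : ℝ) ^ m < U x}
          (fun x => ENNReal.ofReal (β ^ n) ^ 2 * ENNReal.ofReal (max (W x) 0 * U x ^ 2)) x := by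
    filter_upwards [hg, hf, hu] with x h1 h2 h3
    have hF0 : 0 ≤ (f : Lp ℝ 2 μ) x := by
      rw [h2]; exact dyadicSum_nonneg (fun i => sq_nonneg _) h3
    have h4 : W x * U x * (f : Lp ℝ 2 μ) x ≤ max (W x) 0 * (U x * (f : Lp ℝ 2 μ) x) := by
      rw [mul_assoc]
      exact mul_le_mul_of_nonneg_right (le_max_left _ _) (mul_nonneg h3 hF0)
    by_cases hx : (2 : ℝ) ^ m < U x
    · rw [Set.indicator_of_mem (show x ∈ {x | (2 : ℝ) ^ m < U x} from hx)]
      refine le_trans ?_ le_add_self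
      rw [← ENNReal.ofReal_pow (by positivity), ← ENNReal.ofReal_mul (by positivity)]
      refine ENNReal.ofReal_le_ofReal (h4.trans ?_)
      have h5 : (f : Lp ℝ 2 μ) x ≤ (β ^ n) ^ 2 * U x := by
        rw [h2]
        exact (dyadicSum_le_mul_of_le hb2 h3).trans
          (mul_le_mul_of_nonneg_left (min_le_left _ _) (sq_nonneg _))
      calc _ ≤ max (W x) 0 * (U x * ((β ^ n) ^ 2 * U x)) :=
            mul_le_mul_of_nonneg_left (mul_le_mul_of_nonneg_left h5 h3) (le_max_right _ _)
        _ = _ := by ring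
    · rw [Set.indicator_of_notMem (show x ∉ {x | (2 : ℝ) ^ m < U x} from hx), add_zero,
        ← ENNReal.ofReal_mul (by positivity)]
      refine ENNReal.ofReal_le_ofReal (h4.trans ?_)
      have h5 := mul_dyadicSum_sq_le (n := n) hβ h3 (not_lt.1 hx)
      rw [← h1, ← h2] at h5
      calc _ ≤ max (W x) 0 * (4 * β * (g : Lp ℝ 2 μ) x ^ 2) :=
            mul_le_mul_of_nonneg_left h5 (le_max_right _ _)
        _ = _ := by ring
  have hgm : AEMeasurable (fun x => (g : Lp ℝ 2 μ) x) μ :=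
    (Lp.stronglyMeasurable (g : Lp ℝ 2 μ)).measurable.aemeasurable
  have hnn : 0 ≤ 1 / (8 * β) * E.form g g + c * ‖g‖ ^ 2 := by
    have := E.nonneg g
    positivity
  have hle : ENNReal.ofReal (E.form u f)
      ≤ ENNReal.ofReal (4 * β * (1 / (8 * β) * E.form g g + c * ‖g‖ ^ 2) + 1) := by
    rw [heq, ENNReal.ofReal_add (by positivity) zero_le_one, ENNReal.ofReal_one,
      ENNReal.ofReal_mul (by positivity)]
    refine (ofReal_integral_le_lintegral hint).trans ((lintegral_mono_ae hpt).trans ?_)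
    rw [lintegral_add_left' (by fun_prop),
      lintegral_indicator (measurableSet_lt measurable_const hUm),
      lintegral_const_mul' _ _ ENNReal.ofReal_ne_top]
    gcongr
    exact hc g
  have h6 := hgf.trans ((ENNReal.ofReal_le_ofReal_iff (by positivity)).1 hle)
  have h7 : 4 * β * (1 / (8 * β) * E.form g g + c * ‖g‖ ^ 2) + 1
      = E.form g g / 2 + 4 * β * c * ‖g‖ ^ 2 + 1 := by field_simp; ring
  rw [h7] at h6
  linarith

/-- One Moser step: `G(u)` is bounded in `L²` through `u ∈ L² ∩ L^p`, hence in energy, hence by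
Sobolev in `L^(2ν/(ν-2))`, uniformly in `n`. -/
theorem memLp_mul_of_memLp (E : DirichletForm μ) {ν A B : ℝ} (hν : 2 < ν) (hA : 0 < A) (hB : 0 < B)
    (hSob : E.SobolevInequality ν A B) {W : M → ℝ}
    (hW : AEMeasurable W μ) (hWpos : E.InfinitesimallyFormBounded (fun x => max (W x) 0))
    {u : E.domain} (hu : ∀ᵐ x ∂μ, 0 ≤ (u : Lp ℝ 2 μ) x) (hsol : E.IsSolution W u)
    {p : ℝ} (hp : 2 ≤ p) (hup : MemLp ((u : Lp ℝ 2 μ) : M → ℝ) (ENNReal.ofReal p) μ) :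
    MemLp ((u : Lp ℝ 2 μ) : M → ℝ) (ENNReal.ofReal (p * (ν / (ν - 2)))) μ := by
  have hβ := one_le_two_rpow_half hp
  set β : ℝ := 2 ^ ((p - 2) / 2) with hβdef
  obtain ⟨C, hC0, hC⟩ := E.exists_dyadicSum_form_le hW hWpos hu hsol hβ
  choose m hmn g hg hgE using hC
  set U : M → ℝ := fun x => (u : Lp ℝ 2 μ) x with hU
  have hUm : Measurable U := (Lp.stronglyMeasurable (u : Lp ℝ 2 μ)).measurable
  set r : ENNReal := ENNReal.ofReal (2 * ν / (ν - 2)) with hr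
  have hi1 : Integrable (fun x => U x ^ 2) μ := (Lp.memLp (u : Lp ℝ 2 μ)).integrable_sq
  have hi2 : Integrable (fun x => U x ^ p) μ := by
    have := hup.integrable_norm_rpow (by simpa using by linarith) ENNReal.ofReal_ne_top
    rw [ENNReal.toReal_ofReal (by linarith)] at this
    refine this.congr ?_
    filter_upwards [hu] with x hx
    rw [Real.norm_of_nonneg hx]
  set I := ∫ x, (U x ^ 2 + β ^ 2 * U x ^ p) ∂μ with hI
  have hgI : ∀ n, ‖g n‖ ^ 2 ≤ I := fun n => by
    rw [Submodule.coe_norm, L2_norm_sq_eq_integral]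
    refine integral_mono_ae (Lp.memLp _).integrable_sq (hi1.add (hi2.const_mul _)) ?_
    filter_upwards [hg n, hu] with x h1 h2
    simp only [h1]
    exact dyadicSum_sq_le_rpow hp h2
  have hgS : ∀ n, eLpNorm ((g n : Lp ℝ 2 μ) : M → ℝ) r μ ^ 2
      ≤ ENNReal.ofReal (A * (C * I + 2) + B * I) := fun n => by
    refine (hSob (g n)).trans (ENNReal.ofReal_le_ofReal ?_)
    have h1 := hgI n
    have h2 : E.form (g n) (g n) ≤ C * I + 2 :=
      (hgE n).trans (by have := mul_le_mul_of_nonneg_left h1 hC0; linarith)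
    exact add_le_add (mul_le_mul_of_nonneg_left h2 hA.le) (mul_le_mul_of_nonneg_left h1 hB.le)
  set K := ENNReal.ofReal (A * (C * I + 2) + B * I) with hK
  have hgK : ∀ n, eLpNorm ((g n : Lp ℝ 2 μ) : M → ℝ) r μ ≤ K ^ (1 / 2 : ℝ) := fun n => by
    rw [one_div, ENNReal.le_rpow_inv_iff (by norm_num)]
    exact_mod_cast hgS n
  have hbound : ∀ n, eLpNorm (fun x => min (U x) (2 ^ n) ^ (p / 2)) r μ
      ≤ ENNReal.ofReal (4 * β) * K ^ (1 / 2 : ℝ) := fun n => by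
    refine (eLpNorm_le_mul_eLpNorm_of_ae_le_mul (c := 4 * β)
      (g := ((g n : Lp ℝ 2 μ) : M → ℝ)) ?_ r).trans (mul_le_mul_right (hgK n) _)
    filter_upwards [hg n, hu] with x h1 h2
    rw [h1, Real.norm_of_nonneg (Real.rpow_nonneg (le_min h2 (by positivity)) _),
      Real.norm_of_nonneg (dyadicSum_nonneg (truncPow_nonneg hβ) h2)]
    exact min_rpow_le_dyadicSum hp h2 (hmn n)
  -- Fatou as `n → ∞`; at each point the truncations are eventually equal to `U x`.
  have hlim : eLpNorm (fun x => U x ^ (p / 2)) r μ ≤ ENNReal.ofReal (4 * β) * K ^ (1 / 2 : ℝ) := by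
    refine (Lp.eLpNorm_lim_le_liminf_eLpNorm
      (f := fun (n : ℕ) x => min (U x) (2 ^ n) ^ (p / 2)) (fun n => ?_) _ ?_).trans
      (liminf_le_of_le (by isBoundedDefault) fun b hb => ?_)
    · exact ((hUm.min measurable_const).pow_const _).aestronglyMeasurable
    · refine Eventually.of_forall fun x => tendsto_const_nhds.congr' ?_
      obtain ⟨N, hN⟩ := pow_unbounded_of_one_lt (U x) one_lt_two
      filter_upwards [eventually_ge_atTop N] with n hn
      rw [min_eq_left (hN.le.trans (pow_le_pow_right₀ one_le_two hn))]
    · obtain ⟨n, hn⟩ := hb.exists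
      exact hn.trans (hbound n)
  have hmem : MemLp (fun x => U x ^ (p / 2)) r μ :=
    ⟨(hUm.pow_const _).aestronglyMeasurable, hlim.trans_lt
      (ENNReal.mul_lt_top ENNReal.ofReal_lt_top (ENNReal.rpow_lt_top_of_nonneg (by norm_num)
        ENNReal.ofReal_ne_top))⟩
  have hp0 : 0 < p := by linarith
  have hν0 : 0 < ν - 2 := by linarith
  rw [← memLp_norm_rpow_iff (q := ENNReal.ofReal (p / 2)) hUm.aestronglyMeasurable
    (by simpa using by linarith) ENNReal.ofReal_ne_top, ← ENNReal.ofReal_div_of_pos (by positivity),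
    ENNReal.toReal_ofReal (by positivity)]
  have he : p * (ν / (ν - 2)) / (p / 2) = 2 * ν / (ν - 2) := by field_simp
  rw [he]
  refine hmem.ae_eq ?_
  filter_upwards [hu] with x hx
  rw [Real.norm_of_nonneg hx]

end

end DirichletForm

/-! ### Iteration -/

theorem mainTheorem6 {M : Type*} [TopologicalSpace M] [CompactSpace M]
    [MeasurableSpace M] [BorelSpace M] (μ : Measure M) [IsFiniteMeasure μ] [μ.Regular]
    (E : DirichletForm μ) (hreg : E.IsRegular) (hloc : E.StronglyLocal)
    (ν A B : ℝ) (hν : 2 < ν) (hA : 0 < A) (hB : 0 < B) (hSob : E.SobolevInequality ν A B)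
    (W : M → ℝ) (hW : Integrable W μ)
    (hWpos : E.InfinitesimallyFormBounded (fun x => max (W x) 0))
    (u : E.domain) (hu : 0 ≤ (u : Lp ℝ 2 μ)) (hsol : E.IsSolution W u) :
    ∀ q : ℝ, 2 ≤ q → MemLp ((u : Lp ℝ 2 μ) : M → ℝ) (ENNReal.ofReal q) μ := by
  intro q _
  have hu' : ∀ᵐ x ∂μ, 0 ≤ (u : Lp ℝ 2 μ) x := (Lp.coeFn_nonneg _).2 hu
  have hκ : 1 < ν / (ν - 2) := by rw [one_lt_div (by linarith)]; linarith
  have hiter : ∀ k : ℕ,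
      MemLp ((u : Lp ℝ 2 μ) : M → ℝ) (ENNReal.ofReal (2 * (ν / (ν - 2)) ^ k)) μ := by
    intro k
    induction k with
    | zero => simpa using Lp.memLp (u : Lp ℝ 2 μ)
    | succ k ih =>
      have h1 : 1 ≤ (ν / (ν - 2)) ^ k := one_le_pow₀ hκ.le
      have := E.memLp_mul_of_memLp hν hA hB hSob hW.aemeasurable hWpos hu' hsol
        (by linarith) ih
      rwa [mul_assoc, ← pow_succ] at this
  -- The exponents `2κ^k` are unbounded, and `L^r` spaces decrease in `r` because `μ` is finite.
  obtain ⟨k, hk⟩ := pow_unbounded_of_one_lt q hκ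
  refine (hiter k).mono_exponent (ENNReal.ofReal_le_ofReal ?_)
  have h1 : 1 ≤ (ν / (ν - 2)) ^ k := one_le_pow₀ hκ.le
  linarith
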